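/- Let $V_0$ be a (finite-dimensional) Euclidean vector space with complexification $V = V_0\otimes_{\mathbb R}\mathbb C$, equipped with the norm $|x+iy|^2=|x|^2+|y|^2$ $(x,y\in V_0)$, and write $\operatorname{Re}(x+iy)=x$. Let $\mathrm{PW}(V)$ be the space of holomorphic functions $f:V\to\mathbb C$ such that $$\sup_{\lambda\in V,\ |\operatorname{Re}\lambda|\le k}(1+|\lambda|)^N|f(\lambda)|<\infty\qquad\text{for all } N,k\in\mathbb N .$$ Let $W$ be a finite group of linear isometries of $V_0$ generated by (orthogonal) reflections in hyperplanes. It acts $\mathbb C$-linearly on $V$; let $\mathrm{PW}(V)^W$ be the subspace of those $f\in\mathrm{PW}(V)$ with $f(w\lambda)=f(\lambda)$ for all $w\in W$, $\lambda\in V$. Then there exist finitely many homogeneous complex polynomials $p_1,\dots,p_m\in\mathbb C[V]$ such that $$\mathrm{PW}(V)=\sum_{i=1}^m p_i\,\mathrm{PW}(V)^W,$$ and this sum is free: every $f\in\mathrm{PW}(V)$ has exactly one decomposition $f=\sum_{i=1}^m p_if_i$ with $f_1,\dots,f_m\in\mathrm{PW}(V)^W$. -/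

import Mathlib

open scoped TensorProduct InnerProductSpace

noncomputable section

/-- The complexification `ℂ ⊗ V₀` of a Euclidean space `V₀`. Its norm is the Euclidean one,
`‖x + i y‖² = ‖x‖² + ‖y‖²`, coming from the real inner product on the tensor product. -/
abbrev Complexification (V₀ : Type*) [NormedAddCommGroup V₀] [InnerProductSpace ℝ V₀] : Type _ :=
  ℂ ⊗[ℝ] V₀

namespace Complexification

theorem inner_smul_conj {V₀ : Type*} [NormedAddCommGroup V₀] [InnerProductSpace ℝ V₀]
    (c : ℂ) (x y : Complexification V₀) :
    inner ℝ (c • x) y = inner ℝ x ((starRingEnd ℂ c) • y) := by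
  induction x using TensorProduct.induction_on with
  | zero => simp
  | add x₁ x₂ h₁ h₂ => rw [smul_add, inner_add_left, inner_add_left, h₁, h₂]
  | tmul a u =>
    induction y using TensorProduct.induction_on with
    | zero => simp
    | add y₁ y₂ h₁ h₂ => rw [smul_add, inner_add_right, inner_add_right, h₁, h₂]
    | tmul b v =>
      simp only [TensorProduct.smul_tmul', TensorProduct.inner_tmul, smul_eq_mul]
      congr 1
      simp only [Complex.inner, map_mul, Complex.mul_re, Complex.mul_im, Complex.conj_re,
        Complex.conj_im]
      ring

/-- The Euclidean norm on the complexification is a norm of complex vector spaces. -/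
instance instNormedSpaceComplex {V₀ : Type*} [NormedAddCommGroup V₀] [InnerProductSpace ℝ V₀] :
    NormedSpace ℂ (Complexification V₀) where
  norm_smul_le c x := by
    have h : ‖c • x‖ ^ 2 = (‖c‖ * ‖x‖) ^ 2 := by
      rw [← real_inner_self_eq_norm_sq, inner_smul_conj, smul_smul, Complex.conj_mul', mul_pow,
        ← real_inner_self_eq_norm_sq x, ← real_inner_smul_right]
      congr 1
      rw [← Complex.ofReal_pow, ← Complex.coe_algebraMap, algebraMap_smul]
    exact (pow_left_inj₀ (norm_nonneg _) (by positivity) two_ne_zero).1 h |>.le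

/-- The real part `x + i y ↦ x` of an element of the complexification. -/
def re {V₀ : Type*} [NormedAddCommGroup V₀] [InnerProductSpace ℝ V₀] :
    Complexification V₀ →ₗ[ℝ] V₀ :=
  (TensorProduct.lid ℝ V₀).toLinearMap ∘ₗ Complex.reLm.rTensor V₀

/-- The action of a linear isometry of `V₀` on the complexification: `x + i y ↦ w x + i w y`. -/
def act {V₀ : Type*} [NormedAddCommGroup V₀] [InnerProductSpace ℝ V₀] (w : V₀ ≃ₗᵢ[ℝ] V₀) :
    Complexification V₀ →ₗ[ℂ] Complexification V₀ :=
  w.toLinearEquiv.toLinearMap.baseChange ℂ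

end Complexification

/-- `s` is the orthogonal reflection in the hyperplane `v⊥` for some `v ≠ 0`. -/
def IsHyperplaneReflection {V₀ : Type*} [NormedAddCommGroup V₀] [InnerProductSpace ℝ V₀]
    (s : V₀ ≃ₗᵢ[ℝ] V₀) : Prop :=
  ∃ v : V₀, v ≠ 0 ∧ s = (ℝ ∙ v)ᗮ.reflection

/-- `W` is generated by (orthogonal) reflections. -/
def IsGeneratedByReflections {V₀ : Type*} [NormedAddCommGroup V₀] [InnerProductSpace ℝ V₀]
    (W : Subgroup (V₀ ≃ₗᵢ[ℝ] V₀)) : Prop :=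
  ∃ S : Set (V₀ ≃ₗᵢ[ℝ] V₀), (∀ s ∈ S, IsHyperplaneReflection s) ∧ W = Subgroup.closure S

/-- The algebra `ℂ[V]` of complex polynomial functions on a complex vector space `V`: the algebra
of functions generated by the linear functionals. -/
def complexPolynomialFunctions (V : Type*) [AddCommGroup V] [Module ℂ V] : Subalgebra ℂ (V → ℂ) :=
  Algebra.adjoin ℂ (Set.range fun φ : Module.Dual ℂ V => (φ : V → ℂ))

/-- A homogeneous polynomial function (of some degree `d`). -/
def IsHomogeneousPolynomialFunction {V : Type*} [AddCommGroup V] [Module ℂ V]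
    (p : V → ℂ) : Prop :=
  p ∈ complexPolynomialFunctions V ∧ ∃ d : ℕ, ∀ (c : ℂ) (z : V), p (c • z) = c ^ d * p z

/-- The Paley-Wiener space `PW(V)`: holomorphic functions `f` on the complexification `V` of `V₀`
such that `(1 + |z|)^N |f z|` is bounded on `{z : |Re z| ≤ k}` for all `N, k ∈ ℕ`. -/
def paleyWiener (V₀ : Type*) [NormedAddCommGroup V₀] [InnerProductSpace ℝ V₀] :
    Submodule ℂ (Complexification V₀ → ℂ) where
  carrier := {f | Differentiable ℂ f ∧ ∀ N k : ℕ, ∃ C : ℝ, ∀ z : Complexification V₀,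
    ‖Complexification.re z‖ ≤ k → (1 + ‖z‖) ^ N * ‖f z‖ ≤ C}
  zero_mem' := ⟨differentiable_const 0, fun N k => ⟨0, fun z _ => by simp⟩⟩
  add_mem' := by
    rintro f g ⟨hf, hf'⟩ ⟨hg, hg'⟩
    refine ⟨hf.add hg, fun N k => ?_⟩
    obtain ⟨A, hA⟩ := hf' N k
    obtain ⟨B, hB⟩ := hg' N k
    refine ⟨A + B, fun z hz => ?_⟩
    calc (1 + ‖z‖) ^ N * ‖f z + g z‖ ≤ (1 + ‖z‖) ^ N * (‖f z‖ + ‖g z‖) := by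
          gcongr; exact norm_add_le _ _
      _ = (1 + ‖z‖) ^ N * ‖f z‖ + (1 + ‖z‖) ^ N * ‖g z‖ := by ring
      _ ≤ A + B := add_le_add (hA z hz) (hB z hz)
  smul_mem' := by
    rintro c f ⟨hf, hf'⟩
    refine ⟨hf.const_smul c, fun N k => ?_⟩
    obtain ⟨A, hA⟩ := hf' N k
    refine ⟨‖c‖ * A, fun z hz => ?_⟩
    calc (1 + ‖z‖) ^ N * ‖c • f z‖ = ‖c‖ * ((1 + ‖z‖) ^ N * ‖f z‖) := by
          rw [norm_smul]; ring
      _ ≤ ‖c‖ * A := by gcongr; exact hA z hz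

/-- The space `PW(V)^W` of `W`-invariant elements of `PW(V)`. -/
def paleyWienerInvariants {V₀ : Type*} [NormedAddCommGroup V₀] [InnerProductSpace ℝ V₀]
    (W : Subgroup (V₀ ≃ₗᵢ[ℝ] V₀)) : Submodule ℂ (Complexification V₀ → ℂ) where
  carrier := {f | f ∈ paleyWiener V₀ ∧ ∀ w ∈ W, ∀ z, f (Complexification.act w z) = f z}
  zero_mem' := ⟨(paleyWiener V₀).zero_mem, fun _ _ _ => rfl⟩
  add_mem' := fun hf hg => ⟨(paleyWiener V₀).add_mem hf.1 hg.1, fun w hw z => by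
    simp only [Pi.add_apply, hf.2 w hw z, hg.2 w hw z]⟩
  smul_mem' := fun c _ hf => ⟨(paleyWiener V₀).smul_mem c hf.1, fun w hw z => by
    simp only [Pi.smul_apply, hf.2 w hw z]⟩

end

/-!
Write `S` for the polynomial functions on `V`, `R` for the `W`-invariant ones, and
`Δ_s f = (f - f ∘ s) / α_s` for the divided difference attached to a reflection `s ∈ W` with root
`α_s`. The operators `Δ_s` are linear over the invariants, lower the degree of a homogeneous
polynomial by one, and preserve the Paley-Wiener space (`exists_divDiff_mem_paleyWiener`). At a
regular point, the value of a composite of divided differences of `f` depends only on the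
restriction of `f` to the orbit of the point.

Since `S` is integral over `R`, it is generated over `R` by finitely many homogeneous polynomials;
let `p_1, …, p_m` be such a family with `m` minimal. By minimality, the coefficients of each
relation `∑ p_i t_i = 0` with `t_i ∈ R` vanish at the origin
(`exists_minimal_isHomogeneousGenerating`). The `p_i` are the required polynomials.

*Existence.* A composite of more divided differences than all the degrees of the `p_i` kills every
`p_i`, hence `S`, hence, at the regular points, every function, because on a finite orbit
every function agrees with a polynomial (`IsReflectionSystem.iterDivDiff_eq_zero`). So each
`f ∈ PW(V)` is killed by all sufficiently long composites, and induction on their length shows that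
`f` lies in the `S`-span `M` of `PW(V)^W`: if all `Δ_s f` lie in `M`, so does each
`f - f ∘ s = α_s Δ_s f`, hence also the difference of `f` and its average over `W`, and the average
is in `PW(V)^W` (`IsReflectionSystem.exists_sum_of_stable`). Finally `M = ∑ p_i PW(V)^W`, since
`S = ∑ p_i R`.

*Uniqueness.* It suffices that the restrictions of the `p_i` to a regular orbit are linearly
independent (`IsReflectionSystem.coeff_eq_zero_of_sum_eq_zero_on_orbit`), since regular points are
dense. If a nontrivial combination of the `p_i` vanishes on the orbit, its part `h` of highest
degree `d` is not in the ideal generated by the invariants that vanish at the origin. By Chevalley's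
argument (`IsReflectionSystem.exists_iterDivDiff_eq_const`), some composite of `d` divided
differences maps `h` to a nonzero constant. It kills the terms of lower degree, and its value on
the combination is zero on the orbit, a contradiction.
-/

/-! ### Polynomial functions and their homogeneous components -/

section PolynomialFunctions

variable {V : Type*} [AddCommGroup V] [Module ℂ V]

/-- `p` is a polynomial function, homogeneous of degree `d`. The zero function is homogeneous of
every degree. -/
def IsHomogeneousOfDegree (d : ℕ) (p : V → ℂ) : Prop :=
  p ∈ complexPolynomialFunctions V ∧ ∀ (c : ℂ) (z : V), p (c • z) = c ^ d * p z

theorem dual_mem_complexPolynomialFunctions (φ : Module.Dual ℂ V) :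
    (φ : V → ℂ) ∈ complexPolynomialFunctions V :=
  Algebra.subset_adjoin ⟨φ, rfl⟩

theorem const_mem_complexPolynomialFunctions (c : ℂ) :
    (fun _ : V => c) ∈ complexPolynomialFunctions V :=
  (complexPolynomialFunctions V).algebraMap_mem c

theorem comp_linearMap_mem_complexPolynomialFunctions {p : V → ℂ}
    (hp : p ∈ complexPolynomialFunctions V) (L : V →ₗ[ℂ] V) :
    (fun z => p (L z)) ∈ complexPolynomialFunctions V := by
  induction hp using Algebra.adjoin_induction with
  | mem x hx =>
    obtain ⟨φ, rfl⟩ := hx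
    exact dual_mem_complexPolynomialFunctions (φ ∘ₗ L)
  | algebraMap c => exact (complexPolynomialFunctions V).algebraMap_mem c
  | add f g _ _ hf hg => exact add_mem hf hg
  | mul f g _ _ hf hg => exact mul_mem hf hg

namespace IsHomogeneousOfDegree

theorem zero (d : ℕ) : IsHomogeneousOfDegree d (0 : V → ℂ) :=
  ⟨zero_mem _, fun c z => by simp⟩

theorem add {d : ℕ} {p q : V → ℂ} (hp : IsHomogeneousOfDegree d p)
    (hq : IsHomogeneousOfDegree d q) : IsHomogeneousOfDegree d (p + q) :=
  ⟨add_mem hp.1 hq.1, fun c z => by simp only [Pi.add_apply, hp.2, hq.2]; ring⟩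

theorem smul {d : ℕ} {p : V → ℂ} (hp : IsHomogeneousOfDegree d p) (a : ℂ) :
    IsHomogeneousOfDegree d (a • p) :=
  ⟨Subalgebra.smul_mem _ hp.1 a, fun c z => by
    simp only [Pi.smul_apply, smul_eq_mul, hp.2]; ring⟩

theorem sum {ι : Type*} {s : Finset ι} {d : ℕ} {p : ι → V → ℂ}
    (hp : ∀ i ∈ s, IsHomogeneousOfDegree d (p i)) : IsHomogeneousOfDegree d (∑ i ∈ s, p i) := by
  classical
  induction s using Finset.induction_on with
  | empty => simpa using zero d
  | insert a s ha ih =>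
    rw [Finset.sum_insert ha]
    exact (hp a (by simp)).add (ih fun i hi => hp i (by simp [hi]))

theorem sub {d : ℕ} {p q : V → ℂ} (hp : IsHomogeneousOfDegree d p)
    (hq : IsHomogeneousOfDegree d q) : IsHomogeneousOfDegree d (p - q) := by
  simpa [sub_eq_add_neg] using hp.add (hq.smul (-1))

theorem comp_linearMap {d : ℕ} {p : V → ℂ} (hp : IsHomogeneousOfDegree d p) (L : V →ₗ[ℂ] V) :
    IsHomogeneousOfDegree d (fun z => p (L z)) :=
  ⟨comp_linearMap_mem_complexPolynomialFunctions hp.1 L, fun c z => by simp [hp.2]⟩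

theorem apply_zero {d : ℕ} {p : V → ℂ} (hp : IsHomogeneousOfDegree d p) (hd : d ≠ 0) :
    p 0 = 0 := by
  simpa [hd] using hp.2 0 0

theorem apply_eq_apply_zero {p : V → ℂ} (hp : IsHomogeneousOfDegree 0 p) (z : V) :
    p z = p 0 := by
  simpa using (hp.2 0 z).symm

end IsHomogeneousOfDegree

/-- The part of degree `d` of a sum of homogeneous functions is the sum of the terms of
degree `d`. -/
theorem sum_filter_degree_eq {ι : Type*} (s : Finset ι) (deg : ι → ℕ) (k : ι → V → ℂ)
    (hk : ∀ i ∈ s, ∀ (c : ℂ) (z : V), k i (c • z) = c ^ deg i * k i z) {d : ℕ} {F : V → ℂ}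
    (hF : ∀ (c : ℂ) (z : V), F (c • z) = c ^ d * F z) (h : ∑ i ∈ s, k i = F) :
    ∑ i ∈ s with deg i = d, k i = F := by
  funext z
  -- For fixed `z`, compare the coefficients of `c ^ d` in the two sides evaluated at `c • z`.
  have key : ∑ i ∈ s, Polynomial.monomial (deg i) (k i z) = Polynomial.monomial d (F z) := by
    refine Polynomial.funext fun c => ?_
    have := congrFun h (c • z)
    rw [Finset.sum_apply, hF, Finset.sum_congr rfl fun i hi => hk i hi c z] at this
    rw [Polynomial.eval_finsetSum]
    simp only [Polynomial.eval_monomial]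
    rw [mul_comm (F z), ← this]
    exact Finset.sum_congr rfl fun i _ => mul_comm _ _
  have := congrArg (fun P => Polynomial.coeff P d) key
  simp only [Polynomial.finsetSum_coeff, Polynomial.coeff_monomial, if_true] at this
  rw [Finset.sum_apply, Finset.sum_filter]
  exact this

theorem exists_homogeneous_decomposition {p : V → ℂ} (hp : p ∈ complexPolynomialFunctions V) :
    ∃ (n : ℕ) (h : ℕ → V → ℂ), (∀ d, IsHomogeneousOfDegree d (h d)) ∧
      p = ∑ d ∈ Finset.range n, h d := by
  suffices H : ∃ h : ℕ →₀ (V → ℂ), (∀ d, IsHomogeneousOfDegree d (h d)) ∧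
      p = h.sum fun _ x => x by
    obtain ⟨h, hh, rfl⟩ := H
    obtain ⟨n, hn⟩ := h.support.exists_nat_subset_range
    exact ⟨n, h, hh, Finsupp.sum_of_support_subset _ hn _ (by simp)⟩
  have hp' : p ∈ Submodule.span ℂ
      (Submonoid.closure (Set.range fun φ : Module.Dual ℂ V => (φ : V → ℂ)) : Set (V → ℂ)) := by
    rw [← Algebra.adjoin_eq_span]; exact hp
  clear hp
  induction hp' using Submodule.span_induction with
  | mem x hx =>
    have : ∃ d, IsHomogeneousOfDegree d x := by
      induction hx using Submonoid.closure_induction with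
      | mem x hx =>
        obtain ⟨φ, rfl⟩ := hx
        exact ⟨1, dual_mem_complexPolynomialFunctions φ, fun c z => by simp⟩
      | one => exact ⟨0, one_mem _, fun c z => by simp⟩
      | mul f g _ _ hf hg =>
        obtain ⟨a, ha⟩ := hf
        obtain ⟨b, hb⟩ := hg
        exact ⟨a + b, mul_mem ha.1 hb.1, fun c z => by
          simp only [Pi.mul_apply, ha.2, hb.2]; ring⟩
    obtain ⟨d, hd⟩ := this
    refine ⟨Finsupp.single d x, fun e => ?_, by simp⟩
    rw [Finsupp.single_apply]
    split_ifs with h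
    · exact h ▸ hd
    · exact .zero e
  | zero => exact ⟨0, fun d => .zero d, by simp⟩
  | add f g _ _ hf hg =>
    obtain ⟨a, ha, rfl⟩ := hf
    obtain ⟨b, hb, rfl⟩ := hg
    exact ⟨a + b, fun d => (ha d).add (hb d),
      (Finsupp.sum_add_index' (fun _ => rfl) fun _ _ _ => rfl).symm⟩
  | smul c f _ hf =>
    obtain ⟨a, ha, rfl⟩ := hf
    refine ⟨c • a, fun d => (ha d).smul c, ?_⟩
    rw [Finsupp.sum_smul_index' (fun _ => rfl), Finsupp.smul_sum]

/-- Polynomial functions interpolate arbitrary values on a finite set. -/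
theorem exists_polynomial_interpolation (T : Finset V) (f : V → ℂ) :
    ∃ q ∈ complexPolynomialFunctions V, ∀ x ∈ T, q x = f x := by
  classical
  induction T using Finset.induction_on with
  | empty => exact ⟨0, zero_mem _, by simp⟩
  | insert a T ha ih =>
    obtain ⟨q, hq, hqT⟩ := ih
    have hsep : ∀ y ∈ T, ∃ φ : Module.Dual ℂ V, φ (a - y) ≠ 0 := fun y hy => by
      by_contra! h
      have := sub_eq_zero.1 ((Module.forall_dual_apply_eq_zero_iff ℂ _).1 h)
      exact ha (this ▸ hy)
    choose! φ hφ using hsep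
    -- `e` is a Lagrange polynomial: it vanishes on `T` but not at `a`.
    set e : V → ℂ := ∏ y ∈ T, ((φ y : V → ℂ) - fun _ => φ y y) with he
    have hemem : e ∈ complexPolynomialFunctions V := prod_mem fun y _ =>
      sub_mem (dual_mem_complexPolynomialFunctions _) (const_mem_complexPolynomialFunctions _)
    have hea : e a ≠ 0 := by
      rw [he, Finset.prod_apply]
      refine Finset.prod_ne_zero_iff.2 fun y hy => ?_
      simpa using hφ y hy
    have heT : ∀ x ∈ T, e x = 0 := fun x hx => by
      rw [he, Finset.prod_apply]
      exact Finset.prod_eq_zero hx (by simp)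
    refine ⟨q + ((f a - q a) / e a) • e, add_mem hq (Subalgebra.smul_mem _ hemem _), ?_⟩
    intro x hx
    rcases Finset.mem_insert.1 hx with rfl | hx
    · simp [div_mul_cancel₀ _ hea]
    · simp [heT x hx, hqT x hx]

end PolynomialFunctions

/-! ### Invariant polynomials and the average over the group -/

section Invariants

variable {V : Type*} [AddCommGroup V] [Module ℂ V] {G : Type*} [Group G]
  (ρ : Representation ℂ G V)

/-- The algebra `ℂ[V]^G` of invariant polynomial functions of a representation `V` of `G`. -/
noncomputable def invariantPolynomials : Subalgebra ℂ (V → ℂ) where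
  carrier := {p | p ∈ complexPolynomialFunctions V ∧ ∀ g z, p (ρ g z) = p z}
  mul_mem' hp hq := ⟨mul_mem hp.1 hq.1, fun g z => by simp [hp.2 g z, hq.2 g z]⟩
  add_mem' hp hq := ⟨add_mem hp.1 hq.1, fun g z => by simp [hp.2 g z, hq.2 g z]⟩
  algebraMap_mem' c := ⟨Subalgebra.algebraMap_mem _ c, fun _ _ => rfl⟩

/-- The average of a function over the group. -/
noncomputable def groupAverage [Fintype G] (f : V → ℂ) : V → ℂ :=
  (Fintype.card G : ℂ)⁻¹ • ∑ g, fun z => f (ρ g z)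

section Average

variable [Fintype G]

theorem groupAverage_apply (f : V → ℂ) (z : V) :
    groupAverage ρ f z = (Fintype.card G : ℂ)⁻¹ * ∑ g, f (ρ g z) := by
  simp [groupAverage]

theorem groupAverage_apply_rho (f : V → ℂ) (h : G) (z : V) :
    groupAverage ρ f (ρ h z) = groupAverage ρ f z := by
  rw [groupAverage_apply, groupAverage_apply]
  congr 1
  refine Fintype.sum_equiv (Equiv.mulRight h) _ _ fun g => ?_
  simp [map_mul]

theorem groupAverage_eq_self {f : V → ℂ} (hf : ∀ g z, f (ρ g z) = f z) :
    groupAverage ρ f = f := by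
  funext z
  simp [groupAverage_apply, hf]

theorem groupAverage_sum {ι : Type*} (s : Finset ι) (f : ι → V → ℂ) :
    groupAverage ρ (∑ i ∈ s, f i) = ∑ i ∈ s, groupAverage ρ (f i) := by
  funext z
  simp only [groupAverage_apply, Finset.sum_apply]
  rw [Finset.sum_comm, Finset.mul_sum]

theorem IsHomogeneousOfDegree.groupAverage {d : ℕ} {f : V → ℂ}
    (hf : IsHomogeneousOfDegree d f) : IsHomogeneousOfDegree d (groupAverage ρ f) :=
  (IsHomogeneousOfDegree.sum fun g _ => hf.comp_linearMap (ρ g)).smul _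

theorem exists_invariant_homogeneous_decomposition {p : V → ℂ}
    (hp : p ∈ invariantPolynomials ρ) :
    ∃ (n : ℕ) (h : ℕ → V → ℂ), (∀ d, IsHomogeneousOfDegree d (h d)) ∧
      (∀ d, h d ∈ invariantPolynomials ρ) ∧ p = ∑ d ∈ Finset.range n, h d := by
  obtain ⟨n, h, hh, hph⟩ := exists_homogeneous_decomposition hp.1
  refine ⟨n, fun d => groupAverage ρ (h d), fun d => (hh d).groupAverage ρ,
    fun d => ⟨((hh d).groupAverage ρ).1, groupAverage_apply_rho ρ _⟩, ?_⟩
  rw [← groupAverage_sum, ← hph, groupAverage_eq_self ρ hp.2]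

/-- If a set of functions consists of invariants, then a function which agrees modulo its
`ℂ[V]`-span `J` with its translates by generators of the group agrees modulo `J` with its
average: `J` is stable under the group. -/
theorem sub_groupAverage_mem_span {T : Set (V → ℂ)} (hT : ∀ t ∈ T, ∀ g z, t (ρ g z) = t z)
    {A : Set G} (hA : Subgroup.closure A = ⊤) {f : V → ℂ}
    (hf : ∀ s ∈ A, (f - fun z => f (ρ s z)) ∈ Submodule.span (complexPolynomialFunctions V) T) :
    f - groupAverage ρ f ∈ Submodule.span (complexPolynomialFunctions V) T := by
  set J := Submodule.span (complexPolynomialFunctions V) T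
  have hcomp : ∀ (g : G) (q : V → ℂ), q ∈ J → (fun z => q (ρ g z)) ∈ J := fun g q hq => by
    induction hq using Submodule.span_induction with
    | mem t ht =>
      rw [show (fun z => t (ρ g z)) = t from funext (hT t ht g)]
      exact Submodule.subset_span ht
    | zero => exact J.zero_mem
    | add a b _ _ ha hb => exact J.add_mem ha hb
    | smul c a _ ha =>
      exact J.smul_mem ⟨_, comp_linearMap_mem_complexPolynomialFunctions c.2 (ρ g)⟩ ha
  have hall : ∀ g : G, (f - fun z => f (ρ g z)) ∈ J := fun g => by
    have hg : g ∈ Subgroup.closure A := hA ▸ Subgroup.mem_top g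
    induction hg using Subgroup.closure_induction with
    | mem s hs => exact hf s hs
    | one => simp
    | mul g h _ _ hg hh =>
      have := J.add_mem hh (hcomp h _ hg)
      convert this using 1
      funext z
      simp [map_mul]
    | inv g _ hg =>
      have := J.neg_mem (hcomp g⁻¹ _ hg)
      convert this using 1
      funext z
      simp
  have : f - groupAverage ρ f =
      (algebraMap ℂ (complexPolynomialFunctions V) (Fintype.card G : ℂ)⁻¹) •
        ∑ g : G, (f - fun z => f (ρ g z)) := by
    funext z
    have hc : (Fintype.card G : ℂ) ≠ 0 := by simp
    rw [algebraMap_smul]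
    simp only [Pi.sub_apply, groupAverage_apply, Pi.smul_apply, Finset.sum_apply,
      Finset.sum_sub_distrib, Finset.sum_const, Finset.card_univ, nsmul_eq_mul, smul_eq_mul,
      Pi.mul_apply, Pi.natCast_apply]
    field_simp
  rw [this]
  exact J.smul_mem _ (J.sum_mem fun g _ => hall g)

/-- Every linear functional `φ` is a root of the monic polynomial `∏ g, (X - φ ∘ g)`, whose
coefficients are invariant. -/
theorem isIntegral_dual (φ : Module.Dual ℂ V) :
    IsIntegral (invariantPolynomials ρ) (φ : V → ℂ) := by
  let φg : G → V → ℂ := fun g z => φ (ρ g z)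
  have hφg : ∀ g, φg g ∈ complexPolynomialFunctions V := fun g =>
    dual_mem_complexPolynomialFunctions (φ ∘ₗ ρ g)
  let P : Polynomial (V → ℂ) := ∏ g, (Polynomial.X - Polynomial.C (φg g))
  have hP : P.Monic := Polynomial.monic_prod_of_monic _ _ fun g _ => Polynomial.monic_X_sub_C _
  have hroot : P.eval (φ : V → ℂ) = 0 := by
    rw [Polynomial.eval_prod]
    refine Finset.prod_eq_zero (Finset.mem_univ 1) ?_
    rw [Polynomial.eval_sub, Polynomial.eval_X, Polynomial.eval_C, sub_eq_zero]
    funext z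
    simp [φg]
  have hpoly : ∀ n, P.coeff n ∈ complexPolynomialFunctions V := fun n => by
    have : P ∈ Polynomial.lifts (algebraMap (complexPolynomialFunctions V) (V → ℂ)) := by
      refine prod_mem fun g _ => ?_
      rw [sub_eq_add_neg, ← Polynomial.C_neg]
      exact add_mem (Polynomial.X_mem_lifts _)
        (Polynomial.C'_mem_lifts ⟨⟨_, neg_mem (hφg g)⟩, rfl⟩)
    obtain ⟨x, hx⟩ := (Polynomial.lifts_iff_coeff_lifts _).1 this n
    exact hx ▸ x.2
  have hinv : ∀ n g z, P.coeff n (ρ g z) = P.coeff n z := fun n g z => by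
    -- Pulling back along `ρ g` permutes the factors of `P`.
    let σ : (V → ℂ) →+* (V → ℂ) := RingHom.pi fun z => Pi.evalRingHom (fun _ : V => ℂ) (ρ g z)
    have hσ : ∀ (f : V → ℂ) z, σ f z = f (ρ g z) := fun _ _ => rfl
    have hmap : P.map σ = P := by
      rw [Polynomial.map_prod]
      refine Fintype.prod_equiv (Equiv.mulRight g) _ _ fun h => ?_
      rw [Polynomial.map_sub, Polynomial.map_X, Polynomial.map_C]
      congr 2
      funext z
      simp [hσ, φg, map_mul]
    conv_rhs => rw [← hmap, Polynomial.coeff_map, hσ]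
  have hlift : P ∈ Polynomial.lifts (algebraMap (invariantPolynomials ρ) (V → ℂ)) :=
    (Polynomial.lifts_iff_coeff_lifts _).2 fun n => ⟨⟨_, hpoly n, hinv n⟩, rfl⟩
  obtain ⟨Q, hQP, -, hQ⟩ := Polynomial.lifts_and_natDegree_eq_and_monic hlift hP
  refine ⟨Q, hQ, ?_⟩
  rw [← Polynomial.eval_map, hQP, hroot]

end Average

end Invariants

/-! ### Minimal homogeneous generators over the invariants -/

section Generators

variable {V : Type*} [AddCommGroup V] [Module ℂ V] {G : Type*} [Group G]
  (ρ : Representation ℂ G V)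

/-- The homogeneous polynomial functions `p i`, of degree `deg i`, generate `ℂ[V]` as a module
over the invariants. -/
structure IsHomogeneousGenerating {ι : Type*} (p : ι → V → ℂ) (deg : ι → ℕ) : Prop where
  homogeneous : ∀ i, IsHomogeneousOfDegree (deg i) (p i)
  mem_span : ∀ q ∈ complexPolynomialFunctions V,
    q ∈ Submodule.span (invariantPolynomials ρ) (Set.range p)

variable {ρ}

theorem IsHomogeneousGenerating.exists_sum {ι : Type*} [Fintype ι] {p : ι → V → ℂ}
    {deg : ι → ℕ} (hp : IsHomogeneousGenerating ρ p deg) {q : V → ℂ}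
    (hq : q ∈ complexPolynomialFunctions V) :
    ∃ r : ι → V → ℂ, (∀ i, r i ∈ invariantPolynomials ρ) ∧ q = ∑ i, p i * r i := by
  obtain ⟨c, hc⟩ := (Submodule.mem_span_range_iff_exists_fun _).1 (hp.mem_span q hq)
  refine ⟨fun i => c i, fun i => (c i).2, ?_⟩
  rw [← hc]
  exact Finset.sum_congr rfl fun i _ => by rw [Subalgebra.smul_def, smul_eq_mul, mul_comm]

variable (ρ)

theorem exists_isHomogeneousGenerating [Fintype G] [FiniteDimensional ℂ V] :
    ∃ (m : ℕ) (p : Fin m → V → ℂ) (deg : Fin m → ℕ), IsHomogeneousGenerating ρ p deg := by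
  classical
  let b := Module.finBasis ℂ V
  let x : Set (V → ℂ) := Set.range fun i => (b.coord i : V → ℂ)
  have hfg := fg_adjoin_of_finite (R := invariantPolynomials ρ) (s := x) (Set.finite_range _)
    (by rintro _ ⟨i, rfl⟩; exact isIntegral_dual ρ _)
  have hx : ∀ i, (b.coord i : V → ℂ) ∈ Algebra.adjoin (invariantPolynomials ρ) x := fun i =>
    Algebra.subset_adjoin ⟨i, rfl⟩
  -- The algebra generated by the coordinates over the invariants is the algebra of polynomials.
  have hle : ∀ q ∈ complexPolynomialFunctions V,
      q ∈ Algebra.adjoin (invariantPolynomials ρ) x := fun q hq => by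
    induction hq using Algebra.adjoin_induction with
    | mem q hq =>
      obtain ⟨φ, rfl⟩ := hq
      have : (φ : V → ℂ) = ∑ i, algebraMap ℂ (invariantPolynomials ρ) (φ (b i)) •
          (b.coord i : V → ℂ) := by
        funext z
        conv_lhs => rw [← b.sum_repr z, map_sum]
        simp only [algebraMap_smul, Finset.sum_apply, Pi.smul_apply, smul_eq_mul, map_smul,
          Module.Basis.coord_apply]
        exact Finset.sum_congr rfl fun i _ => mul_comm _ _
      rw [show (fun φ : Module.Dual ℂ V => (φ : V → ℂ)) φ = _ from this]
      exact sum_mem fun i _ => Subalgebra.smul_mem _ (hx i) _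
    | algebraMap c =>
      exact Subalgebra.algebraMap_mem _ (algebraMap ℂ (invariantPolynomials ρ) c)
    | add f g _ _ hf hg => exact add_mem hf hg
    | mul f g _ _ hf hg => exact mul_mem hf hg
  have hge : ∀ q ∈ Algebra.adjoin (invariantPolynomials ρ) x,
      q ∈ complexPolynomialFunctions V := fun q hq => by
    induction hq using Algebra.adjoin_induction with
    | mem q hq =>
      obtain ⟨i, rfl⟩ := hq
      exact dual_mem_complexPolynomialFunctions _
    | algebraMap c => exact c.2.1
    | add f g _ _ hf hg => exact add_mem hf hg
    | mul f g _ _ hf hg => exact mul_mem hf hg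
  obtain ⟨T, hT⟩ := hfg
  have hTpoly : ∀ t : T, (t : V → ℂ) ∈ complexPolynomialFunctions V := fun t =>
    hge _ (hT.le (Submodule.subset_span t.2))
  choose n h hh hsum using fun t : T => exists_homogeneous_decomposition (hTpoly t)
  let e := Fintype.equivFin (Σ t : T, Fin (n t))
  let k : (Σ t : T, Fin (n t)) → V → ℂ := fun x => h x.1 x.2
  refine ⟨_, fun i => k (e.symm i), fun i => (e.symm i).2, fun i => hh _ _, fun q hq => ?_⟩
  have hq' := hT.ge (hle q hq)
  refine Submodule.span_le.2 (fun t ht => ?_) hq'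
  have := hsum ⟨t, ht⟩
  rw [SetLike.mem_coe, show t = _ from this, Finset.sum_range]
  exact sum_mem fun d _ => Submodule.subset_span ⟨e ⟨⟨t, ht⟩, d⟩, congrArg k (e.symm_apply_apply _)⟩

/-- There is a finite homogeneous generating family of `ℂ[V]` over the invariants which is minimal
in the sense of Nakayama's lemma: the coefficients of each relation vanish at the origin. -/
theorem exists_minimal_isHomogeneousGenerating [Fintype G] [FiniteDimensional ℂ V] :
    ∃ (m : ℕ) (p : Fin m → V → ℂ) (deg : Fin m → ℕ), IsHomogeneousGenerating ρ p deg ∧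
      ∀ t : Fin m → V → ℂ, (∀ i, t i ∈ invariantPolynomials ρ) → ∑ i, p i * t i = 0 →
        ∀ i, t i 0 = 0 := by
  classical
  have hex := exists_isHomogeneousGenerating ρ
  obtain ⟨p, deg, hp⟩ := Nat.find_spec hex
  have hmin := fun k hk => Nat.find_min hex (m := k) hk
  generalize Nat.find hex = m at p deg hp hmin
  refine ⟨m, p, deg, hp, fun t ht hrel i₀ => ?_⟩
  by_contra hne
  choose n h hh hinv hsum using fun i => exists_invariant_homogeneous_decomposition ρ (ht i)
  -- The part of degree `deg i₀` of the relation has coefficients `t'`, and `t' i₀` is a constant.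
  let t' : Fin m → V → ℂ := fun i => ∑ e ∈ Finset.range (n i) with deg i + e = deg i₀, h i e
  have ht' : ∀ i, t' i ∈ invariantPolynomials ρ := fun i => sum_mem fun e _ => hinv i e
  have hrel' : ∑ i, p i * t' i = 0 := by
    have h1 : ∑ x ∈ Finset.univ.sigma fun i => Finset.range (n i), p x.1 * h x.1 x.2 = 0 := by
      rw [Finset.sum_sigma, ← hrel]
      refine Finset.sum_congr rfl fun i _ => ?_
      rw [hsum i, Finset.mul_sum]
    have h2 := sum_filter_degree_eq _ (fun x : Σ _ : Fin m, ℕ => deg x.1 + x.2) _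
      (fun x _ c z => by
        simp only [Pi.mul_apply, (hp.homogeneous x.1).2, (hh x.1 x.2).2]; ring)
      (d := deg i₀) (fun c z => by simp) h1
    rw [← h2, Finset.sum_filter, Finset.sum_sigma]
    refine Finset.sum_congr rfl fun i _ => ?_
    rw [← Finset.sum_filter, Finset.mul_sum]
  have hconst : t' i₀ = fun _ => t i₀ 0 := by
    funext z
    rw [hsum i₀]
    simp only [t']
    rw [Finset.sum_apply, Finset.sum_apply, Finset.sum_filter]
    refine Finset.sum_congr rfl fun e _ => ?_
    rcases eq_or_ne e 0 with rfl | he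
    · simpa using (hh i₀ 0).apply_eq_apply_zero z
    · simp [he, (hh i₀ e).apply_zero he]
  -- So `p i₀` is a combination of the other generators, contrary to the choice of `m`.
  obtain _ | k := m
  · exact i₀.elim0
  refine hmin k k.lt_succ_self
    ⟨fun j => p (i₀.succAbove j), fun j => deg (i₀.succAbove j), fun j => hp.homogeneous _,
      fun q hq => Submodule.span_le.2 ?_ (hp.mem_span q hq)⟩
  set N := Submodule.span (invariantPolynomials ρ) (Set.range fun j => p (i₀.succAbove j))
  have hj : ∀ j, p (i₀.succAbove j) ∈ N := fun j => Submodule.subset_span ⟨j, rfl⟩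
  rintro _ ⟨i, rfl⟩
  rcases Fin.eq_self_or_eq_succAbove i₀ i with rfl | ⟨j, rfl⟩
  · rw [Fin.sum_univ_succAbove _ i, hconst] at hrel'
    have hpi : p i = (algebraMap ℂ (invariantPolynomials ρ) (-(t i 0)⁻¹)) •
        ∑ j, (⟨_, ht' (i.succAbove j)⟩ : invariantPolynomials ρ) • p (i.succAbove j) := by
      funext z
      have := congrFun hrel' z
      simp only [Pi.add_apply, Pi.mul_apply, Finset.sum_apply, Pi.zero_apply] at this
      simp only [algebraMap_smul, Pi.smul_apply, Finset.sum_apply, Subalgebra.smul_def,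
        smul_eq_mul, Pi.mul_apply]
      rw [neg_mul, ← mul_neg, eq_inv_mul_iff_mul_eq₀ hne]
      rw [mul_comm, eq_neg_iff_add_eq_zero, ← this]
      congr 1
      exact Finset.sum_congr rfl fun j _ => mul_comm _ _
    rw [SetLike.mem_coe, hpi]
    exact N.smul_mem _ (N.sum_mem fun j _ => N.smul_mem _ (hj j))
  · exact hj j

end Generators

/-! ### Divided differences -/

section DividedDifferences

variable {V : Type*} [AddCommGroup V] [Module ℂ V] {G : Type*} [Group G]

/-- The group `G` is generated by the set `A`, each element `s` of which acts on `V` as the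
reflection `z ↦ z - α s z • v s`, where `α s (v s) = 2`. -/
structure IsReflectionSystem (ρ : Representation ℂ G V) (A : Set G) (α : G → Module.Dual ℂ V)
    (v : G → V) : Prop where
  closure_eq_top : Subgroup.closure A = ⊤
  apply_eq : ∀ s ∈ A, ∀ z, ρ s z = z - α s z • v s
  pairing : ∀ s ∈ A, α s (v s) = 2

/-- A point of `V` is regular if it is moved by each group element that acts nontrivially. -/
def IsRegularPoint (ρ : Representation ℂ G V) (z : V) : Prop :=
  ∀ g, ρ g ≠ 1 → ρ g z ≠ z

theorem IsRegularPoint.apply {ρ : Representation ℂ G V} {z : V} (hz : IsRegularPoint ρ z)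
    (h : G) : IsRegularPoint ρ (ρ h z) := by
  intro g hg hfix
  have hconj : ρ (h⁻¹ * g * h) z = z := by
    simp only [map_mul, Module.End.mul_apply, hfix]
    simp
  by_cases h1 : ρ (h⁻¹ * g * h) = 1
  · apply hg
    have : ρ (h * (h⁻¹ * g * h) * h⁻¹) = 1 := by
      rw [map_mul, map_mul, h1, mul_one, ← map_mul, mul_inv_cancel, map_one]
    simpa [mul_assoc] using this
  · exact hz _ h1 hconj

variable (ρ : Representation ℂ G V) (α : G → Module.Dual ℂ V)

/-- The divided difference `(f - f ∘ s) / α s`, with the value `0` on the hyperplane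
`α s = 0`. -/
noncomputable def divDiff (s : G) : (V → ℂ) →ₗ[ℂ] (V → ℂ) where
  toFun f z := (f z - f (ρ s z)) / α s z
  map_add' f g := by funext z; simp only [Pi.add_apply]; ring
  map_smul' c f := by funext z; simp only [Pi.smul_apply, smul_eq_mul, RingHom.id_apply]; ring

theorem divDiff_apply (s : G) (f : V → ℂ) (z : V) :
    divDiff ρ α s f z = (f z - f (ρ s z)) / α s z := rfl

/-- The composite of the divided differences along a list; the head of the list acts first. -/
noncomputable def iterDivDiff : List G → (V → ℂ) →ₗ[ℂ] (V → ℂ)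
  | [] => LinearMap.id
  | s :: l => iterDivDiff l ∘ₗ divDiff ρ α s

@[simp] theorem iterDivDiff_nil (f : V → ℂ) : iterDivDiff ρ α [] f = f := rfl

theorem iterDivDiff_cons (s : G) (l : List G) (f : V → ℂ) :
    iterDivDiff ρ α (s :: l) f = iterDivDiff ρ α l (divDiff ρ α s f) := rfl

/-- The value at `z` of an iterated divided difference of `f` depends only on the restriction of
`f` to the orbit of `z`. -/
theorem iterDivDiff_congr (l : List G) {f f' : V → ℂ} {z : V}
    (h : ∀ g, f (ρ g z) = f' (ρ g z)) : iterDivDiff ρ α l f z = iterDivDiff ρ α l f' z := by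
  induction l generalizing f f' with
  | nil => simpa using h 1
  | cons s l ih =>
    rw [iterDivDiff_cons, iterDivDiff_cons]
    refine ih fun g => ?_
    have := h (s * g)
    rw [map_mul, Module.End.mul_apply] at this
    rw [divDiff_apply, divDiff_apply, h g, this]

theorem iterDivDiff_mul_invariant (l : List G) (f : V → ℂ) {r : V → ℂ}
    (hr : ∀ g z, r (ρ g z) = r z) :
    iterDivDiff ρ α l (f * r) = iterDivDiff ρ α l f * r := by
  induction l generalizing f with
  | nil => rfl
  | cons s l ih =>
    rw [iterDivDiff_cons, iterDivDiff_cons, ← ih]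
    congr 1
    funext z
    simp only [divDiff_apply, Pi.mul_apply, hr]
    ring

variable {ρ α} {A : Set G} {v : G → V}

namespace IsReflectionSystem

theorem root_ne_zero (hA : IsReflectionSystem ρ A α v) {s : G} (hs : s ∈ A) {z : V}
    (hz : IsRegularPoint ρ z) : α s z ≠ 0 := by
  intro h0
  have h1 : ρ s ≠ 1 := fun h => by
    have h2 := hA.apply_eq s hs (v s)
    rw [h, Module.End.one_apply, hA.pairing s hs] at h2
    have h3 : v s = 0 := by simpa using h2.symm
    simpa [h3] using hA.pairing s hs
  exact hz s h1 (by rw [hA.apply_eq s hs, h0, zero_smul, sub_zero])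

theorem divDiff_eq (hA : IsReflectionSystem ρ A α v) {s : G} (hs : s ∈ A) {f q : V → ℂ}
    (hq : ∀ z, f z - f (ρ s z) = α s z * q z) {z : V} (hz : IsRegularPoint ρ z) :
    divDiff ρ α s f z = q z := by
  rw [divDiff_apply, hq, mul_div_cancel_left₀ _ (hA.root_ne_zero hs hz)]

theorem iterDivDiff_cons_eq (hA : IsReflectionSystem ρ A α v) {s : G} (hs : s ∈ A)
    (l : List G) {f q : V → ℂ} (hq : ∀ z, f z - f (ρ s z) = α s z * q z) {z : V}
    (hz : IsRegularPoint ρ z) :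
    iterDivDiff ρ α (s :: l) f z = iterDivDiff ρ α l q z :=
  iterDivDiff_congr ρ α l fun g => hA.divDiff_eq hs hq (hz.apply g)

theorem exists_polynomial_divDiff (hA : IsReflectionSystem ρ A α v) {s : G} (hs : s ∈ A)
    {p : V → ℂ} (hp : p ∈ complexPolynomialFunctions V) :
    ∃ q ∈ complexPolynomialFunctions V, ∀ z, p z - p (ρ s z) = α s z * q z := by
  induction hp using Algebra.adjoin_induction with
  | mem p hp =>
    obtain ⟨φ, rfl⟩ := hp
    refine ⟨fun _ => φ (v s), const_mem_complexPolynomialFunctions _, fun z => ?_⟩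
    simp [hA.apply_eq s hs]
  | algebraMap c => exact ⟨0, zero_mem _, fun z => by simp [Pi.algebraMap_apply]⟩
  | add f g _ _ hf hg =>
    obtain ⟨a, ha, hfa⟩ := hf
    obtain ⟨b, hb, hgb⟩ := hg
    refine ⟨a + b, add_mem ha hb, fun z => ?_⟩
    simp only [Pi.add_apply]
    linear_combination hfa z + hgb z
  | mul f g hf' hg' hf hg =>
    -- The twisted Leibniz rule.
    obtain ⟨a, ha, hfa⟩ := hf
    obtain ⟨b, hb, hgb⟩ := hg
    refine ⟨a * g + (fun z => f (ρ s z)) * b, add_mem (mul_mem ha hg')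
      (mul_mem (comp_linearMap_mem_complexPolynomialFunctions hf' (ρ s)) hb), fun z => ?_⟩
    simp only [Pi.add_apply, Pi.mul_apply]
    linear_combination g z * hfa z + f (ρ s z) * hgb z

theorem exists_homogeneous_divDiff (hA : IsReflectionSystem ρ A α v) {s : G} (hs : s ∈ A)
    {d : ℕ} {p : V → ℂ} (hp : IsHomogeneousOfDegree (d + 1) p) :
    ∃ q, IsHomogeneousOfDegree d q ∧ ∀ z, p z - p (ρ s z) = α s z * q z := by
  obtain ⟨q, hq, hpq⟩ := hA.exists_polynomial_divDiff hs hp.1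
  obtain ⟨n, h, hh, rfl⟩ := exists_homogeneous_decomposition hq
  have hF := hp.sub (hp.comp_linearMap (ρ s))
  have key := sum_filter_degree_eq (Finset.range n) (fun e => e + 1)
    (fun e => (α s : V → ℂ) * h e)
    (fun e _ c z => by simp only [Pi.mul_apply, (hh e).2, map_smul, smul_eq_mul]; ring)
    hF.2 (by
      rw [← Finset.mul_sum]
      funext z
      exact (hpq z).symm)
  refine ⟨∑ e ∈ Finset.range n with e + 1 = d + 1, h e, .sum fun e he => ?_, fun z => ?_⟩
  · rw [← Nat.succ_injective (Finset.mem_filter.1 he).2]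
    exact hh e
  · rw [← Finset.mul_sum] at key
    exact (congrFun key z).symm

/-- Divided differences lower the degree by one, so that too many of them kill a homogeneous
polynomial. -/
theorem iterDivDiff_homogeneous_eq_zero (hA : IsReflectionSystem ρ A α v) {d : ℕ} {p : V → ℂ}
    (hp : IsHomogeneousOfDegree d p) {l : List G} (hl : ∀ s ∈ l, s ∈ A) (hd : d < l.length)
    {z : V} (hz : IsRegularPoint ρ z) : iterDivDiff ρ α l p z = 0 := by
  induction l generalizing d p with
  | nil => simp at hd
  | cons s l ih =>
    have hs : s ∈ A := hl s (by simp)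
    obtain _ | d := d
    · rw [hA.iterDivDiff_cons_eq hs l (q := 0) (fun z => ?_) hz]
      · simp
      · rw [hp.apply_eq_apply_zero, hp.apply_eq_apply_zero (ρ s z)]
        simp
    · obtain ⟨q, hq, hpq⟩ := hA.exists_homogeneous_divDiff hs hp
      rw [hA.iterDivDiff_cons_eq hs l hpq hz]
      exact ih hq (fun t ht => hl t (by simp [ht])) (by simpa using hd)

/-- A composite of more divided differences than the degrees of the generators of `ℂ[V]` over the
invariants kills every function at the regular points: it kills the polynomials because it is
linear over the invariants, and a polynomial can take the same values as a given function
on an orbit. -/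
theorem iterDivDiff_eq_zero [Finite G] (hA : IsReflectionSystem ρ A α v) {m : ℕ}
    {p : Fin m → V → ℂ} {deg : Fin m → ℕ} (hp : IsHomogeneousGenerating ρ p deg) (f : V → ℂ)
    {l : List G} (hl : ∀ s ∈ l, s ∈ A) (hd : ∀ i, deg i < l.length)
    {z : V} (hz : IsRegularPoint ρ z) : iterDivDiff ρ α l f z = 0 := by
  obtain ⟨q, hq, hqf⟩ := exists_polynomial_interpolation
    (Set.finite_range fun g => ρ g z).toFinset f
  rw [iterDivDiff_congr ρ α l (f' := q) fun g => (hqf _ (by simp)).symm]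
  obtain ⟨r, hr, rfl⟩ := hp.exists_sum hq
  rw [map_sum, Finset.sum_apply]
  refine Finset.sum_eq_zero fun i _ => ?_
  rw [iterDivDiff_mul_invariant ρ α l _ (hr i).2, Pi.mul_apply,
    hA.iterDivDiff_homogeneous_eq_zero (hp.homogeneous i) hl (hd i) hz, zero_mul]

/-- Chevalley's argument: a homogeneous polynomial of degree `d` outside the ideal generated by the
invariants that vanish at the origin is mapped to a nonzero constant by a suitable composite of
`d` divided differences. -/
theorem exists_iterDivDiff_eq_const [Fintype G] (hA : IsReflectionSystem ρ A α v) {d : ℕ}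
    {h : V → ℂ} (hh : IsHomogeneousOfDegree d h)
    (hI : h ∉ Submodule.span (complexPolynomialFunctions V)
      {t | t ∈ invariantPolynomials ρ ∧ t 0 = 0}) :
    ∃ l : List G, (∀ s ∈ l, s ∈ A) ∧ l.length = d ∧ ∃ c : ℂ, c ≠ 0 ∧
      ∀ z, IsRegularPoint ρ z → iterDivDiff ρ α l h z = c := by
  induction d generalizing h with
  | zero =>
    refine ⟨[], by simp, rfl, h 0, fun h0 => hI ?_, fun z _ => hh.apply_eq_apply_zero z⟩
    have : h = 0 := funext fun z => by rw [hh.apply_eq_apply_zero, h0, Pi.zero_apply]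
    exact this ▸ Submodule.zero_mem _
  | succ d ih =>
    have hex : ∃ s ∈ A, ∃ q, IsHomogeneousOfDegree d q ∧
        (∀ z, h z - h (ρ s z) = α s z * q z) ∧
        q ∉ Submodule.span (complexPolynomialFunctions V)
          {t | t ∈ invariantPolynomials ρ ∧ t 0 = 0} := by
      by_contra! hcon
      have havg := sub_groupAverage_mem_span ρ (fun t ht => ht.1.2) hA.closure_eq_top (f := h)
        (T := {t | t ∈ invariantPolynomials ρ ∧ t 0 = 0}) fun s hs => by
          obtain ⟨q, hq, hhq⟩ := hA.exists_homogeneous_divDiff hs hh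
          have hmem := Submodule.smul_mem _
            (⟨α s, dual_mem_complexPolynomialFunctions (α s)⟩ : complexPolynomialFunctions V)
            (hcon s hs q hq hhq)
          convert hmem using 1
          funext z
          exact hhq z
      have hhom := hh.groupAverage ρ
      have := Submodule.add_mem _ havg (Submodule.subset_span
        ⟨⟨hhom.1, groupAverage_apply_rho ρ h⟩, hhom.apply_zero d.succ_ne_zero⟩)
      exact hI (by simpa using this)
    obtain ⟨s, hs, q, hq, hhq, hqI⟩ := hex
    obtain ⟨l, hl, hlen, c, hc, hlc⟩ := ih hq hqI
    refine ⟨s :: l, by simpa [hs] using hl, by simp [hlen], c, hc, fun z hz => ?_⟩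
    rw [hA.iterDivDiff_cons_eq hs l hhq hz, hlc z hz]

end IsReflectionSystem

end DividedDifferences

/-! ### Expansion in the generators and its uniqueness -/

section Expansion

variable {V : Type*} [AddCommGroup V] [Module ℂ V] {G : Type*} [Group G]
  {ρ : Representation ℂ G V}

/-- The `ℂ[V]`-span of an `R`-stable space `T`, where `R` is the algebra of invariant polynomials,
is the sum of the spaces `p i * T`, since `ℂ[V]` is the sum of the `p i * R`. -/
theorem IsHomogeneousGenerating.exists_sum_of_mem_span {m : ℕ} {p : Fin m → V → ℂ}
    {deg : Fin m → ℕ} (hp : IsHomogeneousGenerating ρ p deg) (T : Submodule ℂ (V → ℂ))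
    (hT : ∀ r ∈ invariantPolynomials ρ, ∀ t ∈ T, r * t ∈ T) {f : V → ℂ}
    (hf : f ∈ Submodule.span (complexPolynomialFunctions V) (T : Set (V → ℂ))) :
    ∃ t : Fin m → V → ℂ, (∀ i, t i ∈ T) ∧ f = ∑ i, p i * t i := by
  obtain ⟨n, q, t, rfl⟩ := Submodule.mem_span_set'.1 hf
  choose r hr hqr using fun k => hp.exists_sum (q k).2
  refine ⟨fun i => ∑ k, r k i * t k, fun i => T.sum_mem fun k _ => hT _ (hr k i) _ (t k).2, ?_⟩
  simp_rw [Finset.mul_sum]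
  rw [Finset.sum_comm]
  refine Finset.sum_congr rfl fun k _ => ?_
  rw [Subalgebra.smul_def, smul_eq_mul, hqr k, Finset.sum_mul]
  exact Finset.sum_congr rfl fun i _ => mul_assoc _ _ _

variable (ρ) in
/-- The invariant polynomial functions that vanish at the origin. -/
noncomputable def invariantPolynomialsVanishing : Submodule ℂ (V → ℂ) where
  carrier := {t | t ∈ invariantPolynomials ρ ∧ t 0 = 0}
  zero_mem' := ⟨zero_mem _, rfl⟩
  add_mem' ha hb := ⟨add_mem ha.1 hb.1, by simp [ha.2, hb.2]⟩
  smul_mem' c _ ha := ⟨Subalgebra.smul_mem _ ha.1 c, by simp [ha.2]⟩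

namespace IsReflectionSystem

variable {A : Set G} {α : G → Module.Dual ℂ V} {v : G → V}

/-- The restrictions of a minimal family of generators to a regular orbit are linearly
independent: the part of highest degree of a nontrivial linear combination `q` is mapped to a
nonzero constant by a composite of divided differences that kills the part of lower
degree, whereas the value of the composite on `q` is zero if `q` vanishes on the orbit. -/
theorem coeff_eq_zero_of_sum_eq_zero_on_orbit [Fintype G] (hA : IsReflectionSystem ρ A α v)
    {m : ℕ} {p : Fin m → V → ℂ} {deg : Fin m → ℕ} (hp : IsHomogeneousGenerating ρ p deg)
    (hmin : ∀ t : Fin m → V → ℂ, (∀ i, t i ∈ invariantPolynomials ρ) → ∑ i, p i * t i = 0 →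
      ∀ i, t i 0 = 0)
    {z : V} (hz : IsRegularPoint ρ z) (c : Fin m → ℂ)
    (hc : ∀ g, ∑ i, c i * p i (ρ g z) = 0) (i : Fin m) : c i = 0 := by
  classical
  by_contra hi
  obtain ⟨i₀, hi₀, hmax⟩ := Finset.exists_max_image (Finset.univ.filter fun i => c i ≠ 0) deg
    ⟨i, by simpa using hi⟩
  have hci₀ : c i₀ ≠ 0 := (Finset.mem_filter.1 hi₀).2
  set D := deg i₀ with hD
  set h : V → ℂ := ∑ i with deg i = D, c i • p i with hh
  have hhom : IsHomogeneousOfDegree D h := .sum fun j hj =>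
    ((Finset.mem_filter.1 hj).2 ▸ hp.homogeneous j).smul _
  have hI : h ∉ Submodule.span (complexPolynomialFunctions V)
      {t | t ∈ invariantPolynomials ρ ∧ t 0 = 0} := fun hmem => by
    obtain ⟨t, ht, hht⟩ := hp.exists_sum_of_mem_span (invariantPolynomialsVanishing ρ)
      (fun r hr t ht => ⟨mul_mem hr ht.1, by simp [ht.2]⟩) hmem
    have := hmin (fun j => (fun _ => if deg j = D then c j else 0) - t j)
      (fun j => sub_mem ((invariantPolynomials ρ).algebraMap_mem _) (ht j).1)
      (by
        rw [← sub_eq_zero.2 hht, hh, Finset.sum_filter, ← Finset.sum_sub_distrib]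
        refine Finset.sum_congr rfl fun j _ => ?_
        funext z
        split_ifs <;> simp [mul_sub, mul_comm])
      i₀
    simp [(ht i₀).2, ← hD] at this
    exact hci₀ this
  obtain ⟨l, hl, hlen, a, ha, hla⟩ := hA.exists_iterDivDiff_eq_const hhom hI
  refine ha ?_
  rw [← hla z hz]
  have h0 : iterDivDiff ρ α l (∑ i, c i • p i) z = 0 := by
    rw [iterDivDiff_congr ρ α l (f' := 0) (by simpa [Finset.sum_apply] using hc)]
    simp
  rw [← h0, hh, map_sum, map_sum, Finset.sum_apply, Finset.sum_apply, Finset.sum_filter]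
  refine Finset.sum_congr rfl fun j _ => ?_
  split_ifs with hj
  · rfl
  · rw [map_smul, Pi.smul_apply, smul_eq_mul]
    rcases eq_or_ne (c j) 0 with hcj | hcj
    · rw [hcj, zero_mul]
    · have hle : deg j ≤ D := hmax j (by simpa using hcj)
      rw [hA.iterDivDiff_homogeneous_eq_zero (hp.homogeneous j) hl
        (hlen ▸ lt_of_le_of_ne hle hj) hz, mul_zero]

/-- Let `P` be a `ℂ[V]`-module of functions that is stable under divided differences and whose
elements are determined by their values at regular points. Then the generators of
`ℂ[V]` over the invariants generate `P` over its invariants.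

The proof is by induction on the number `k` such that all composites of `k` divided differences
kill `f`. If the divided differences of `f` lie in the `ℂ[V]`-span `M` of the invariants of `P`,
then `f - f ∘ s` lies in `M` for each generating reflection `s`, hence so does the difference of
`f` and its average. -/
theorem exists_sum_of_stable [Fintype G] (hA : IsReflectionSystem ρ A α v)
    {m : ℕ} {p : Fin m → V → ℂ} {deg : Fin m → ℕ} (hp : IsHomogeneousGenerating ρ p deg)
    {P T : Submodule ℂ (V → ℂ)} (hT : ∀ f, f ∈ T ↔ f ∈ P ∧ ∀ g z, f (ρ g z) = f z)
    (hmul : ∀ q ∈ complexPolynomialFunctions V, ∀ f ∈ P, q * f ∈ P)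
    (hdiv : ∀ s ∈ A, ∀ f ∈ P, ∃ q ∈ P, ∀ z, f z - f (ρ s z) = α s z * q z)
    (hreg : ∀ f ∈ P, (∀ z, IsRegularPoint ρ z → f z = 0) → f = 0) {f : V → ℂ} (hf : f ∈ P) :
    ∃ t : Fin m → V → ℂ, (∀ i, t i ∈ T) ∧ f = ∑ i, p i * t i := by
  refine hp.exists_sum_of_mem_span T (fun r hr t ht => (hT _).2
    ⟨hmul r hr.1 t ((hT t).1 ht).1, fun g z => by simp [hr.2 g z, ((hT t).1 ht).2 g z]⟩) ?_
  set M := Submodule.span (complexPolynomialFunctions V) (T : Set (V → ℂ))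
  have hMP : ∀ q ∈ M, q ∈ P := fun q hq => by
    induction hq using Submodule.span_induction with
    | mem t ht => exact ((hT t).1 ht).1
    | zero => exact P.zero_mem
    | add a b _ _ ha hb => exact P.add_mem ha hb
    | smul c a _ ha => exact hmul _ c.2 a ha
  have hlevel : ∀ (k : ℕ), ∀ f ∈ P, (∀ l : List G, (∀ s ∈ l, s ∈ A) → l.length = k →
      ∀ z, IsRegularPoint ρ z → iterDivDiff ρ α l f z = 0) → f ∈ M := by
    intro k
    induction k with
    | zero =>
      intro f hf h0
      rw [hreg f hf fun z hz => h0 [] (by simp) rfl z hz]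
      exact M.zero_mem
    | succ k ih =>
      intro f hf hk
      have havg := sub_groupAverage_mem_span ρ (fun t ht => ((hT t).1 ht).2) hA.closure_eq_top
        (f := f) (T := (T : Set (V → ℂ))) fun s hs => by
          obtain ⟨q, hq, hfq⟩ := hdiv s hs f hf
          have hqM : q ∈ M := ih q hq fun l hl hlen z hz => by
            rw [← hA.iterDivDiff_cons_eq hs l hfq hz]
            exact hk (s :: l) (by simpa [hs] using hl) (by simp [hlen]) z hz
          have hmem := M.smul_mem
            (⟨α s, dual_mem_complexPolynomialFunctions (α s)⟩ : complexPolynomialFunctions V) hqM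
          convert hmem using 1
          funext z
          exact hfq z
      have hT' : groupAverage ρ f ∈ T := (hT _).2
        ⟨by simpa using P.sub_mem hf (hMP _ havg), groupAverage_apply_rho ρ f⟩
      simpa using M.add_mem havg (Submodule.subset_span hT')
  obtain ⟨k, hk⟩ : ∃ k, ∀ i, deg i < k :=
    ⟨Finset.univ.sup deg + 1, fun i => Nat.lt_succ_of_le (Finset.le_sup (Finset.mem_univ i))⟩
  exact hlevel k f hf fun l hl hlen z hz => hA.iterDivDiff_eq_zero hp f hl (by simpa [hlen]) hz

end IsReflectionSystem

end Expansion

/-! ### Difference quotients of holomorphic functions of several variables -/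

section HolomorphicDifferenceQuotient

variable {E : Type*} [NormedAddCommGroup E] [NormedSpace ℂ E]

/-- Differentiation of a parametric interval integral whose integrand has a jointly continuous
derivative in the parameter. -/
theorem differentiableAt_intervalIntegral_of_continuousOn_fderiv [ProperSpace E] {a b : ℝ}
    {F : E → ℝ → ℂ} {F' : E → ℝ → E →L[ℂ] ℂ} {U : Set E} (hU : IsOpen U)
    (hF : ∀ z ∈ U, ∀ t, HasFDerivAt (fun z => F z t) (F' z t) z)
    (hFc : ∀ z ∈ U, Continuous (F z))
    (hF' : ContinuousOn (Function.uncurry F') (U ×ˢ Set.univ)) {z₀ : E} (hz₀ : z₀ ∈ U) :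
    DifferentiableAt ℂ (fun z => ∫ t in a..b, F z t) z₀ := by
  obtain ⟨r, hr, hrU⟩ := Metric.nhds_basis_closedBall.mem_iff.1 (hU.mem_nhds hz₀)
  have hcpt : IsCompact (Metric.closedBall z₀ r ×ˢ Set.uIcc a b) :=
    (isCompact_closedBall z₀ r).prod isCompact_uIcc
  obtain ⟨C, hC⟩ := hcpt.exists_bound_of_continuousOn
    (hF'.mono (Set.prod_mono hrU (Set.subset_univ _)))
  refine (intervalIntegral.hasFDerivAt_integral_of_dominated_of_fderiv_le (𝕜 := ℂ) (F' := F')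
    (bound := fun _ => C) (Metric.closedBall_mem_nhds z₀ hr) ?_
    ((hFc z₀ hz₀).intervalIntegrable a b) ?_ ?_ intervalIntegrable_const ?_).differentiableAt
  · filter_upwards [hU.mem_nhds hz₀] with z hz
    exact (hFc z hz).aestronglyMeasurable
  · refine Continuous.aestronglyMeasurable ?_
    exact hF'.comp_continuous (f := fun t => (z₀, t)) (by fun_prop) fun t => ⟨hz₀, trivial⟩
  · exact .of_forall fun t ht z hz => hC (z, t) ⟨hz, Set.uIoc_subset_uIcc ht⟩
  · exact .of_forall fun t _ z hz => hF z (hrU hz) t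

/-- A holomorphic function on a finite-dimensional space is continuously differentiable. -/
theorem Differentiable.continuous_fderiv_complex [FiniteDimensional ℂ E] {f : E → ℂ}
    (hf : Differentiable ℂ f) : Continuous (fderiv ℂ f) := by
  refine continuous_clm_apply.2 fun v => ?_
  have hline : ∀ z, fderiv ℂ f z v = (2 * Real.pi * Complex.I : ℂ)⁻¹ •
      ∮ w in C(0, 1), ((w - 0) ^ 2)⁻¹ • f (z + w • v) := fun z => by
    have hd : Differentiable ℂ fun w : ℂ => f (z + w • v) := by fun_prop
    rw [Complex.two_pi_I_inv_smul_circleIntegral_sub_sq_inv_smul_of_differentiable isOpen_univ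
      (Set.subset_univ _) hd.differentiableOn (Metric.mem_ball_self one_pos)]
    have h1 : HasDerivAt (fun w : ℂ => z + w • v) v 0 := by
      simpa using ((hasDerivAt_id (0 : ℂ)).smul_const v).const_add z
    have h2 : HasFDerivAt f (fderiv ℂ f z) (z + (0 : ℂ) • v) := by
      simpa using (hf z).hasFDerivAt
    exact (h2.comp_hasDerivAt (0 : ℂ) h1).deriv.symm
  simp_rw [hline]
  have hfc := hf.continuous
  refine (continuous_const_smul _).comp ?_
  refine intervalIntegral.continuous_parametric_intervalIntegral_of_continuous' ?_ _ _
  have hne : ∀ p : E × ℝ, (circleMap 0 1 p.2 - 0) ^ 2 ≠ 0 := fun p => by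
    simp
  simp only [Function.uncurry_def, deriv_circleMap, smul_eq_mul]
  have h0 : Continuous fun p : E × ℝ => circleMap 0 1 p.2 := by fun_prop
  exact (h0.mul continuous_const).mul ((((h0.sub continuous_const).pow 2).inv₀ hne).mul
    (hfc.comp (continuous_fst.add (h0.smul continuous_const))))

/-- For holomorphic `f`, the holomorphic function whose product with `φ` is
`z ↦ f z - f (z - φ z • v)`: the difference quotient of `f` where `φ z ≠ 0`,
and the derivative of `f` along `v` where `φ z = 0`. -/
noncomputable def lineSlope (φ : E →L[ℂ] ℂ) (v : E) (f : E → ℂ) (z : E) : ℂ :=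
  -dslope (fun w : ℂ => f (z - w • v)) 0 (φ z)

theorem sub_eq_mul_lineSlope (φ : E →L[ℂ] ℂ) (v : E) (f : E → ℂ) (z : E) :
    f z - f (z - φ z • v) = φ z * lineSlope φ v f z := by
  have := sub_smul_dslope (fun w : ℂ => f (z - w • v)) 0 (φ z)
  simp only [sub_zero, zero_smul, smul_eq_mul] at this
  rw [lineSlope, mul_neg, this, neg_sub]

/-- By Cauchy's formula, applied to the difference quotient along a line, `lineSlope φ v f` is
locally a circle integral that depends holomorphically on the point. -/
theorem differentiable_lineSlope [FiniteDimensional ℂ E] (φ : E →L[ℂ] ℂ) (v : E) {f : E → ℂ}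
    (hf : Differentiable ℂ f) : Differentiable ℂ (lineSlope φ v f) := by
  have : ProperSpace E := FiniteDimensional.proper ℂ E
  intro z₀
  set r : ℝ := ‖φ z₀‖ + 1
  have hr0 : 0 < r := by positivity
  set U : Set E := {z | ‖φ z‖ < r}
  have hU : IsOpen U := isOpen_lt (by fun_prop) continuous_const
  have hz₀ : z₀ ∈ U := by simp [U, r]
  have hne : ∀ t, circleMap 0 r t ≠ 0 := fun t => circleMap_ne_center hr0.ne'
  have hne' : ∀ z ∈ U, ∀ t, circleMap 0 r t - φ z ≠ 0 := fun z hz t h => by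
    have h1 : ‖circleMap 0 r t‖ = r := by simp [abs_of_pos hr0]
    rw [sub_eq_zero.1 h] at h1
    exact (ne_of_lt hz) h1
  let F : E → ℝ → ℂ := fun z t =>
    Complex.I * ((circleMap 0 r t - φ z)⁻¹ * (f (z - circleMap 0 r t • v) - f z))
  have hformula : ∀ z ∈ U, lineSlope φ v f z =
      -((2 * Real.pi * Complex.I : ℂ)⁻¹ • ∫ t in (0 : ℝ)..2 * Real.pi, F z t) := by
    intro z hz
    have hd : Differentiable ℂ fun w : ℂ => f (z - w • v) := by fun_prop
    have hd' : DifferentiableOn ℂ (dslope (fun w : ℂ => f (z - w • v)) 0) Set.univ :=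
      (Complex.differentiableOn_dslope Filter.univ_mem).2 hd.differentiableOn
    have hcauchy := (hd'.diffContOnCl_ball (R := r) (c := 0)
      (Set.subset_univ _)).two_pi_i_inv_smul_circleIntegral_sub_inv_smul (w := φ z)
      (mem_ball_zero_iff.2 hz)
    rw [lineSlope, ← hcauchy, circleIntegral]
    congr 3
    funext t
    rw [dslope_of_ne _ (hne t), slope_def_field, deriv_circleMap]
    simp only [F, smul_eq_mul, zero_smul, sub_zero]
    have := hne t
    field_simp
  let F' : E → ℝ → E →L[ℂ] ℂ := fun z t => Complex.I •
    ((circleMap 0 r t - φ z)⁻¹ • (fderiv ℂ f (z - circleMap 0 r t • v) - fderiv ℂ f z) +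
      (f (z - circleMap 0 r t • v) - f z) • (((circleMap 0 r t - φ z) ^ 2)⁻¹ • φ))
  have hfc := hf.continuous
  have hfd := hf.continuous_fderiv_complex
  have hint : DifferentiableAt ℂ (fun z => ∫ t in (0 : ℝ)..2 * Real.pi, F z t) z₀ := by
    refine differentiableAt_intervalIntegral_of_continuousOn_fderiv (F' := F') hU ?_ ?_ ?_ hz₀
    · intro z hz t
      have h1 : HasFDerivAt (fun z => (circleMap 0 r t - φ z)⁻¹)
          (((circleMap 0 r t - φ z) ^ 2)⁻¹ • φ) z := by
        have := (hasDerivAt_inv (hne' z hz t)).comp_hasFDerivAt z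
          (φ.hasFDerivAt.const_sub (circleMap 0 r t) (x := z))
        simpa [Function.comp_def] using this
      have h2 : HasFDerivAt (fun z => f (z - circleMap 0 r t • v) - f z)
          (fderiv ℂ f (z - circleMap 0 r t • v) - fderiv ℂ f z) z := by
        have h3 : HasFDerivAt (fun z => z - circleMap 0 r t • v) (ContinuousLinearMap.id ℂ E) z :=
          (hasFDerivAt_id z).sub_const _
        have h4 := (hf (z - circleMap 0 r t • v)).hasFDerivAt.comp z h3
        rw [ContinuousLinearMap.comp_id] at h4
        exact h4.sub (hf z).hasFDerivAt
      exact (h1.mul h2).const_mul Complex.I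
    · intro z hz
      refine continuous_const.mul (Continuous.mul ?_ ?_)
      · exact (Continuous.sub (by fun_prop) continuous_const).inv₀ (hne' z hz)
      · fun_prop
    · have hden : ContinuousOn (fun p : E × ℝ => circleMap 0 r p.2 - φ p.1)
          (U ×ˢ Set.univ) := by fun_prop
      have hne2 : ∀ p ∈ U ×ˢ (Set.univ : Set ℝ), circleMap 0 r p.2 - φ p.1 ≠ 0 :=
        fun p hp => hne' p.1 hp.1 p.2
      have hpt : Continuous fun p : E × ℝ => p.1 - circleMap 0 r p.2 • v := by fun_prop
      have hsum := ContinuousOn.add (s := U ×ˢ (Set.univ : Set ℝ))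
        (f := fun p => (circleMap 0 r p.2 - φ p.1)⁻¹ •
          (fderiv ℂ f (p.1 - circleMap 0 r p.2 • v) - fderiv ℂ f p.1))
        (g := fun p => (f (p.1 - circleMap 0 r p.2 • v) - f p.1) •
          (((circleMap 0 r p.2 - φ p.1) ^ 2)⁻¹ • φ)) ?_ ?_
      · exact hsum.const_smul Complex.I
      · exact (hden.inv₀ hne2).smul
          ((hfd.comp hpt).sub (hfd.comp continuous_fst)).continuousOn
      · exact ((hfc.comp hpt).sub (hfc.comp continuous_fst)).continuousOn.smul
          (((hden.pow 2).inv₀ fun p hp => pow_ne_zero 2 (hne2 p hp)).smul continuousOn_const)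
  exact ((hint.const_smul (2 * Real.pi * Complex.I : ℂ)⁻¹).neg).congr_of_eventuallyEq
    (Filter.eventuallyEq_of_mem (hU.mem_nhds hz₀) fun z hz => hformula z hz)

end HolomorphicDifferenceQuotient

/-! ### The complexification and its Paley-Wiener space -/

theorem dense_setOf_isRegularPoint {E G : Type*} [NormedAddCommGroup E] [NormedSpace ℂ E]
    [FiniteDimensional ℂ E] [Group G] [Finite G] (ρ : Representation ℂ G E) :
    Dense {z | IsRegularPoint ρ z} := by
  have : CompleteSpace E := FiniteDimensional.complete ℂ E
  have hset : {z | IsRegularPoint ρ z} = ⋂ g, {z | ρ g ≠ 1 → ρ g z ≠ z} := by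
    ext z
    simp [IsRegularPoint]
  rw [hset]
  have hker : ∀ g, ρ g ≠ 1 →
      {z | ρ g ≠ 1 → ρ g z ≠ z} = ((LinearMap.ker (ρ g - 1) : Submodule ℂ E) : Set E)ᶜ :=
    fun g hg => by
      ext z
      simp [hg, sub_eq_zero]
  refine dense_iInter_of_isOpen (fun g => ?_) fun g => ?_
  · by_cases hg : ρ g = 1
    · simp [hg]
    · rw [hker g hg]
      exact (Submodule.closed_of_finiteDimensional _).isOpen_compl
  · by_cases hg : ρ g = 1
    · simp [hg]
    · rw [hker g hg, ← interior_eq_empty_iff_dense_compl, ← Set.not_nonempty_iff_eq_empty]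
      intro hne
      have := Submodule.eq_top_of_nonempty_interior' _ hne
      exact hg (sub_eq_zero.1 (LinearMap.ker_eq_top.1 this))

section PaleyWiener

variable {V₀ : Type*} [NormedAddCommGroup V₀] [InnerProductSpace ℝ V₀]

namespace Complexification

theorem act_tmul (w : V₀ ≃ₗᵢ[ℝ] V₀) (a : ℂ) (x : V₀) : act w (a ⊗ₜ[ℝ] x) = a ⊗ₜ[ℝ] w x := rfl

theorem re_act (w : V₀ ≃ₗᵢ[ℝ] V₀) (z : Complexification V₀) : re (act w z) = w (re z) := by
  induction z using TensorProduct.induction_on with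
  | zero => simp
  | add x y hx hy => simp only [map_add, hx, hy]
  | tmul a x => simp [re, act_tmul]

theorem norm_re_act (w : V₀ ≃ₗᵢ[ℝ] V₀) (z : Complexification V₀) :
    ‖re (act w z)‖ = ‖re z‖ := by
  rw [re_act, w.norm_map]

theorem norm_act (w : V₀ ≃ₗᵢ[ℝ] V₀) (z : Complexification V₀) : ‖act w z‖ = ‖z‖ :=
  TensorProduct.norm_map LinearIsometry.id w.toLinearIsometry z

/-- The action of a group of isometries of `V₀` on the complexification, as a representation. -/
noncomputable def actRepresentation (W : Subgroup (V₀ ≃ₗᵢ[ℝ] V₀)) :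
    Representation ℂ W (Complexification V₀) where
  toFun w := act (w : V₀ ≃ₗᵢ[ℝ] V₀)
  map_one' := by
    refine LinearMap.ext fun z => ?_
    induction z using TensorProduct.induction_on with
    | zero => simp
    | add x y hx hy => rw [map_add, map_add, hx, hy]
    | tmul a x => rfl
  map_mul' g h := by
    refine LinearMap.ext fun z => ?_
    induction z using TensorProduct.induction_on with
    | zero => simp
    | add x y hx hy => rw [map_add, map_add, hx, hy]
    | tmul a x => rfl

theorem exists_act_eq_of_isHyperplaneReflection {s : V₀ ≃ₗᵢ[ℝ] V₀}
    (hs : IsHyperplaneReflection s) :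
    ∃ (α : Module.Dual ℂ (Complexification V₀)) (v : Complexification V₀),
      (∀ z, act s z = z - α z • v) ∧ α v = 2 := by
  obtain ⟨u, hu, rfl⟩ := hs
  have hu' : (‖u‖ : ℂ) ≠ 0 := by simpa using hu
  let l : V₀ →ₗ[ℝ] ℂ := Complex.ofRealCLM.toLinearMap ∘ₗ ((2 / ‖u‖ ^ 2) • innerₗ V₀ u)
  have hl : ∀ x, l x = ((2 / ‖u‖ ^ 2 * inner ℝ u x : ℝ) : ℂ) := fun x => by simp [l]
  refine ⟨l.liftBaseChange ℂ, 1 ⊗ₜ[ℝ] u, fun z => ?_, ?_⟩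
  · induction z using TensorProduct.induction_on with
    | zero => simp
    | add x y hx hy => rw [map_add, map_add, hx, hy, add_smul]; abel
    | tmul a x =>
      rw [act_tmul, Submodule.reflection_orthogonal_apply, Submodule.reflection_singleton_apply,
        neg_sub, TensorProduct.tmul_sub, LinearMap.liftBaseChange_tmul, hl,
        TensorProduct.smul_tmul', ← Nat.cast_smul_eq_nsmul ℝ, smul_smul, ← TensorProduct.smul_tmul,
        Complex.real_smul]
      congr 2
      simp only [smul_eq_mul, mul_one, RCLike.ofReal_real_eq_id, id_eq]
      rw [mul_comm a]
      congr 2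
      push_cast
      ring
  · rw [LinearMap.liftBaseChange_tmul, hl, real_inner_self_eq_norm_sq]
    push_cast
    simp only [one_smul]
    field_simp

end Complexification

open Complexification

theorem mul_mem_paleyWiener [FiniteDimensional ℝ V₀] {q : Complexification V₀ → ℂ}
    (hq : q ∈ complexPolynomialFunctions (Complexification V₀))
    {f : Complexification V₀ → ℂ} (hf : f ∈ paleyWiener V₀) : q * f ∈ paleyWiener V₀ := by
  induction hq using Algebra.adjoin_induction generalizing f with
  | mem q hq =>
    obtain ⟨φ, rfl⟩ := hq
    let φ' : Complexification V₀ →L[ℂ] ℂ := LinearMap.toContinuousLinearMap φ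
    have hφ' : ∀ z, φ z = φ' z := fun _ => rfl
    refine ⟨φ'.differentiable.mul hf.1, fun N k => ?_⟩
    obtain ⟨C, hC⟩ := hf.2 (N + 1) k
    refine ⟨‖φ'‖ * C, fun z hz => ?_⟩
    have hb : ‖φ' z‖ ≤ ‖φ'‖ * (1 + ‖z‖) :=
      (φ'.le_opNorm z).trans (by gcongr; linarith)
    calc (1 + ‖z‖) ^ N * ‖φ z * f z‖ = (1 + ‖z‖) ^ N * (‖φ' z‖ * ‖f z‖) := by
          rw [norm_mul, hφ']
      _ ≤ (1 + ‖z‖) ^ N * (‖φ'‖ * (1 + ‖z‖) * ‖f z‖) := by gcongr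
      _ = ‖φ'‖ * ((1 + ‖z‖) ^ (N + 1) * ‖f z‖) := by ring
      _ ≤ ‖φ'‖ * C := by gcongr; exact hC z hz
  | algebraMap c =>
    rw [← Algebra.smul_def]
    exact (paleyWiener V₀).smul_mem c hf
  | add a b _ _ ha hb => rw [add_mul]; exact (paleyWiener V₀).add_mem (ha hf) (hb hf)
  | mul a b _ _ ha hb => rw [mul_assoc]; exact ha (hb hf)

/-- Divided differences preserve the Paley-Wiener space. The bounds for the quotient `h` by `α` are
clear where `1 ≤ |α z|`. If `|α z| ≤ 1`, the circle of radius `1` about `z` in the direction of the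
coroot `v` lies in that region, since `α v = 2`, and the maximum principle applies. -/
theorem exists_divDiff_mem_paleyWiener [FiniteDimensional ℝ V₀] {s : V₀ ≃ₗᵢ[ℝ] V₀}
    {α : Module.Dual ℂ (Complexification V₀)} {v : Complexification V₀}
    (hs : ∀ z, act s z = z - α z • v) (hαv : α v = 2) {f : Complexification V₀ → ℂ}
    (hf : f ∈ paleyWiener V₀) :
    ∃ h ∈ paleyWiener V₀, ∀ z, f z - f (act s z) = α z * h z := by
  let φ : Complexification V₀ →L[ℂ] ℂ := LinearMap.toContinuousLinearMap α
  have hφ : ∀ z, φ z = α z := fun _ => rfl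
  set h := lineSlope φ v f
  have hfh : ∀ z, f z - f (act s z) = α z * h z := fun z => by
    rw [hs]; exact sub_eq_mul_lineSlope φ v f z
  have hhd : Differentiable ℂ h := differentiable_lineSlope φ v hf.1
  refine ⟨h, ⟨hhd, fun N k => ?_⟩, hfh⟩
  -- The strip `‖re z‖ ≤ j` contains the unit circles in the direction of `v` about the points of
  -- the strip `‖re z‖ ≤ k`.
  obtain ⟨j, hj⟩ := exists_nat_ge ((k : ℝ) + ‖v‖ + ‖re v‖ + ‖re (Complex.I • v)‖)
  obtain ⟨C, hC⟩ := hf.2 N j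
  -- The bound away from the hyperplane.
  have hfar : ∀ z, ‖re z‖ ≤ j → 1 ≤ ‖α z‖ → (1 + ‖z‖) ^ N * ‖h z‖ ≤ 2 * C := fun z hz hα => by
    have h1 := hC z hz
    have h2 := hC (act s z) (by rwa [norm_re_act])
    rw [norm_act] at h2
    calc (1 + ‖z‖) ^ N * ‖h z‖ ≤ (1 + ‖z‖) ^ N * (‖α z‖ * ‖h z‖) := by
          gcongr; exact le_mul_of_one_le_left (norm_nonneg _) hα
      _ = (1 + ‖z‖) ^ N * ‖f z - f (act s z)‖ := by rw [hfh, norm_mul]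
      _ ≤ (1 + ‖z‖) ^ N * (‖f z‖ + ‖f (act s z)‖) := by gcongr; exact norm_sub_le _ _
      _ ≤ 2 * C := by linarith [mul_add ((1 + ‖z‖) ^ N) ‖f z‖ ‖f (act s z)‖]
  have hre : ∀ w : ℂ, ‖w‖ = 1 → ‖re (w • v)‖ ≤ ‖re v‖ + ‖re (Complex.I • v)‖ := fun w hw => by
    have : w • v = w.re • v + w.im • (Complex.I • v) := by
      conv_lhs => rw [← Complex.re_add_im w, add_smul, mul_smul]
      rw [← Complex.coe_algebraMap, algebraMap_smul, algebraMap_smul]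
    rw [this, map_add, map_smul, map_smul]
    refine (norm_add_le _ _).trans ?_
    rw [norm_smul, norm_smul]
    have h1 : ‖w.re‖ ≤ 1 := hw ▸ Complex.abs_re_le_norm w
    have h2 : ‖w.im‖ ≤ 1 := hw ▸ Complex.abs_im_le_norm w
    gcongr
    · exact mul_le_of_le_one_left (norm_nonneg _) h1
    · exact mul_le_of_le_one_left (norm_nonneg _) h2
  have hC0 : 0 ≤ C := le_trans (by positivity) (hC 0 (by simp))
  refine ⟨(1 + ‖v‖) ^ N * (2 * C), fun z hz => ?_⟩
  have hone : 1 ≤ (1 + ‖v‖) ^ N := one_le_pow₀ (by linarith [norm_nonneg v])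
  rcases le_total 1 ‖α z‖ with hα | hα
  · refine (hfar z (hz.trans ?_) hα).trans (le_mul_of_one_le_left (by positivity) hone)
    linarith [norm_nonneg v, norm_nonneg (re v), norm_nonneg (re (Complex.I • v))]
  · -- The maximum principle on the unit disc for `w ↦ h (z + w • v)`.
    have hbound : ∀ w : ℂ, ‖w‖ = 1 →
        ‖h (z + w • v)‖ ≤ (1 + ‖v‖) ^ N * (2 * C) / (1 + ‖z‖) ^ N := fun w hw => by
      rw [le_div_iff₀ (by positivity)]
      have hwα : 1 ≤ ‖α (z + w • v)‖ := by
        rw [map_add, map_smul, hαv, smul_eq_mul]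
        have h1 : ‖w * 2‖ = 2 := by simp [hw]
        have h2 := norm_sub_le (α z + w * 2) (α z)
        rw [add_sub_cancel_left, h1] at h2
        linarith
      have hwre : ‖re (z + w • v)‖ ≤ j := by
        rw [map_add]
        linarith [norm_add_le (re z) (re (w • v)), hre w hw, norm_nonneg v]
      have hnorm : 1 + ‖z‖ ≤ (1 + ‖v‖) * (1 + ‖z + w • v‖) := by
        have h1 := norm_sub_le (z + w • v) (w • v)
        rw [add_sub_cancel_right, norm_smul, hw, one_mul] at h1
        nlinarith [norm_nonneg v, norm_nonneg (z + w • v),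
          mul_nonneg (norm_nonneg v) (norm_nonneg (z + w • v))]
      calc ‖h (z + w • v)‖ * (1 + ‖z‖) ^ N
          ≤ ‖h (z + w • v)‖ * ((1 + ‖v‖) * (1 + ‖z + w • v‖)) ^ N := by gcongr
        _ = (1 + ‖v‖) ^ N * ((1 + ‖z + w • v‖) ^ N * ‖h (z + w • v)‖) := by rw [mul_pow]; ring
        _ ≤ (1 + ‖v‖) ^ N * (2 * C) := 
          mul_le_mul_of_nonneg_left (hfar _ hwre hwα) (by positivity)
    have hd : Differentiable ℂ fun w : ℂ => h (z + w • v) := by fun_prop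
    have hmax := Complex.norm_le_of_forall_mem_frontier_norm_le Metric.isBounded_ball
      (hd.diffContOnCl (s := Metric.ball 0 1)) (fun w hw => hbound w (by
        rw [frontier_ball _ one_ne_zero] at hw; simpa using hw))
      (subset_closure (Metric.mem_ball_self one_pos))
    simp only [zero_smul, add_zero] at hmax
    rwa [le_div_iff₀ (by positivity), mul_comm] at hmax

end PaleyWiener

/-! ### The Paley-Wiener space as a module over its invariants -/

theorem mainTheorem9 {V₀ : Type*} [NormedAddCommGroup V₀] [InnerProductSpace ℝ V₀]
    [FiniteDimensional ℝ V₀] (W : Subgroup (V₀ ≃ₗᵢ[ℝ] V₀)) [Finite W]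
    (hW : IsGeneratedByReflections W) :
    ∃ (m : ℕ) (p : Fin m → Complexification V₀ → ℂ),
      (∀ i, IsHomogeneousPolynomialFunction (p i)) ∧
      paleyWiener V₀ =
        (⨆ i, (paleyWienerInvariants W).map (LinearMap.mulLeft ℂ (p i))) ∧
      ∀ f ∈ paleyWiener V₀, ∃! g : Fin m → Complexification V₀ → ℂ,
        (∀ i, g i ∈ paleyWienerInvariants W) ∧ f = ∑ i, p i * g i := by
  have := Fintype.ofFinite W
  let ρ := Complexification.actRepresentation W
  have hρ : ∀ (w : W) z, ρ w z = Complexification.act w z := fun _ _ => rfl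
  choose! α v hαv using fun (s : W) (hs : IsHyperplaneReflection (s : V₀ ≃ₗᵢ[ℝ] V₀)) =>
    Complexification.exists_act_eq_of_isHyperplaneReflection hs
  have hA : IsReflectionSystem ρ {s : W | IsHyperplaneReflection (s : V₀ ≃ₗᵢ[ℝ] V₀)} α v := by
    refine ⟨?_, fun s hs => (hαv s hs).1, fun s hs => (hαv s hs).2⟩
    obtain ⟨S, hS, rfl⟩ := hW
    exact top_le_iff.1 ((Subgroup.closure_closure_coe_preimage (k := S)).ge.trans
      (Subgroup.closure_mono fun s hs => hS _ hs))
  have hdense := dense_setOf_isRegularPoint ρ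
  obtain ⟨m, p, deg, hp, hmin⟩ := exists_minimal_isHomogeneousGenerating ρ
  have hmem : ∀ f, f ∈ paleyWienerInvariants W ↔
      f ∈ paleyWiener V₀ ∧ ∀ (g : W) z, f (ρ g z) = f z := fun f =>
    ⟨fun hf => ⟨hf.1, fun g z => hf.2 g g.2 z⟩, fun hf => ⟨hf.1, fun w hw z => hf.2 ⟨w, hw⟩ z⟩⟩
  have hexp : ∀ f ∈ paleyWiener V₀, ∃ t : Fin m → Complexification V₀ → ℂ,
      (∀ i, t i ∈ paleyWienerInvariants W) ∧ f = ∑ i, p i * t i := fun f hf =>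
    hA.exists_sum_of_stable hp hmem (fun q hq f hf => mul_mem_paleyWiener hq hf)
      (fun s hs f hf => exists_divDiff_mem_paleyWiener (hαv s hs).1 (hαv s hs).2 hf)
      (fun f hf h0 => hf.1.continuous.ext_on hdense continuous_const h0) hf
  refine ⟨m, p, fun i => ⟨(hp.homogeneous i).1, deg i, (hp.homogeneous i).2⟩, ?_, fun f hf => ?_⟩
  · refine le_antisymm (fun f hf => ?_) (iSup_le fun i => ?_)
    · obtain ⟨t, ht, rfl⟩ := hexp f hf
      exact Submodule.sum_mem _ fun i _ => Submodule.mem_iSup_of_mem i ⟨t i, ht i, rfl⟩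
    · rintro _ ⟨t, ht, rfl⟩
      exact mul_mem_paleyWiener (hp.homogeneous i).1 ht.1
  · obtain ⟨t, ht, hft⟩ := hexp f hf
    refine ⟨t, ⟨ht, hft⟩, fun g ⟨hg, hfg⟩ => funext fun i => ?_⟩
    refine (hg i).1.1.continuous.ext_on hdense (ht i).1.1.continuous fun z hz => ?_
    refine sub_eq_zero.1 (hA.coeff_eq_zero_of_sum_eq_zero_on_orbit hp hmin hz
      (fun i => g i z - t i z) (fun w => ?_) i)
    have h1 := congrFun (hfg.symm.trans hft) (ρ w z)
    simp only [Finset.sum_apply, Pi.mul_apply, ((hmem _).1 (hg _)).2, ((hmem _).1 (ht _)).2] at h1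
    rw [← sub_eq_zero.2 h1, ← Finset.sum_sub_distrib]
    exact Finset.sum_congr rfl fun i _ => by ring
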